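/- Let $A$ be a nonzero commutative ring with unit in which every positive integer is invertible (i.e. $\mathbb{Q}\subset A$), let $X$ be a totally ordered set (an alphabet), and let $\varphi: X\times X\to AX$ be any map into the free $A$-module $AX\subset A\langle X\rangle$ spanned by the letters. Let $⧢_\varphi$ be the $A$-bilinear product on the module $A\langle X\rangle$ of noncommutative polynomials determined on words by $$1⧢_\varphi w=w⧢_\varphi 1=w,\qquad au⧢_\varphi bv=a(u⧢_\varphi bv)+b(au⧢_\varphi v)+\varphi(a,b)(u⧢_\varphi v)$$ for all letters $a,b\in X$ and words $u,v,w\in X^*$, where juxtaposition is concatenation. Suppose that $⧢_\varphi$ is associative and commutative on $A\langle X\rangle$, and let $\mathcal{A}=(A\langle X\rangle,⧢_\varphi,1)$. Let $Lyn(X)$ be the set of Lyndon words, i.e. the nonempty words that are strictly smaller, in the lexicographic order, than each of their nonempty proper right factors. Then: i) $\mathcal{A}$ is a polynomial algebra over $A$, with the Lyndon words as free generators: there is an isomorphism of $A$-algebras $A[t_l : l\in Lyn(X)]\to\mathcal{A}$ that maps each variable $t_l$ to the word $l$. ii) $Lyn(X)$ is a transcendence basis (a maximal algebraically independent family) of $\mathcal{A}$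 over $A$. -/

import Mathlib

noncomputable section

namespace PhiShuffle

universe u v

/-- `A⟨X⟩`: noncommutative polynomials on the alphabet `X` with coefficients in `A`, that is, the
algebra of the free monoid `X^*`. Its multiplication `*` is the concatenation product. -/
abbrev NCPoly (A : Type v) (X : Type u) [CommRing A] : Type (max u v) :=
  MonoidAlgebra A (FreeMonoid X)

/-- The word `w`, seen as an element of `A⟨X⟩`. -/
def word (A : Type v) {X : Type u} [CommRing A] (w : List X) : NCPoly A X :=
  MonoidAlgebra.of A (FreeMonoid X) (FreeMonoid.ofList w)

/-- The inclusion of the homogeneous polynomials of degree one, `AX ⊆ A⟨X⟩`. -/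
def letters (A : Type v) (X : Type u) [CommRing A] : (X →₀ A) →ₗ[A] NCPoly A X :=
  Finsupp.linearCombination A (fun x : X => word A [x])

/-- The `φ`-shuffle of two words, for `φ : X × X → AX`:
`1 ⧢ w = w ⧢ 1 = w` and
`au ⧢ bv = a (u ⧢ bv) + b (au ⧢ v) + φ(a,b) (u ⧢ v)`. -/
def wordShuffle {A : Type v} {X : Type u} [CommRing A] (φ : X → X → (X →₀ A)) :
    List X → List X → NCPoly A X
  | [], w => word A w
  | a :: u, [] => word A (a :: u)
  | a :: u, b :: v =>
      word A [a] * wordShuffle φ u (b :: v) + word A [b] * wordShuffle φ (a :: u) v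
        + letters A X (φ a b) * wordShuffle φ u v
  termination_by u v => u.length + v.length

/-- The `φ`-shuffle product on `A⟨X⟩`: the bilinear extension of `wordShuffle`. -/
def shuffle {A : Type v} {X : Type u} [CommRing A] (φ : X → X → (X →₀ A)) :
    NCPoly A X →ₗ[A] NCPoly A X →ₗ[A] NCPoly A X :=
  (Finsupp.linearCombination A fun w : FreeMonoid X =>
    (Finsupp.linearCombination A fun w' : FreeMonoid X =>
      wordShuffle φ w.toList w'.toList) ∘ₗ
        (MonoidAlgebra.coeffLinearEquiv A).toLinearMap) ∘ₗ
    (MonoidAlgebra.coeffLinearEquiv A).toLinearMap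

/-- The `φ`-shuffle product is associative on `A⟨X⟩`. -/
def ShuffleAssoc {A : Type v} {X : Type u} [CommRing A] (φ : X → X → (X →₀ A)) : Prop :=
  ∀ P Q R : NCPoly A X, shuffle φ (shuffle φ P Q) R = shuffle φ P (shuffle φ Q R)

/-- The `φ`-shuffle product is commutative on `A⟨X⟩`. -/
def ShuffleComm {A : Type v} {X : Type u} [CommRing A] (φ : X → X → (X →₀ A)) : Prop :=
  ∀ P Q : NCPoly A X, shuffle φ P Q = shuffle φ Q P

section basic

variable {A : Type v} {X : Type u} [CommRing A] (φ : X → X → (X →₀ A))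

theorem shuffle_word_word (w w' : List X) :
    shuffle φ (word A w) (word A w') = wordShuffle φ w w' := by
  simp [shuffle, word]

theorem wordShuffle_nil_left (w : List X) : wordShuffle φ [] w = word A w := by
  rw [wordShuffle]

theorem wordShuffle_nil_right (w : List X) : wordShuffle φ w [] = word A w := by
  cases w <;> rw [wordShuffle]

theorem wordShuffle_cons_cons (a b : X) (u v : List X) :
    wordShuffle φ (a :: u) (b :: v) =
      word A [a] * wordShuffle φ u (b :: v) + word A [b] * wordShuffle φ (a :: u) v
        + letters A X (φ a b) * wordShuffle φ u v := by
  rw [wordShuffle]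

theorem linearMap_ext_word {M : Type*} [AddCommMonoid M] [Module A M]
    {f g : NCPoly A X →ₗ[A] M} (h : ∀ w : List X, f (word A w) = g (word A w)) : f = g := by
  refine MonoidAlgebra.lhom_ext' fun w => LinearMap.ext_ring ?_
  simpa [word] using h w.toList

theorem shuffle_one_left (P : NCPoly A X) : shuffle φ (word A []) P = P := by
  have h : shuffle φ (word A []) = LinearMap.id := linearMap_ext_word fun w => by
    rw [shuffle_word_word, wordShuffle_nil_left]; rfl
  rw [h]; rfl

theorem shuffle_one_right (P : NCPoly A X) : shuffle φ P (word A []) = P := by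
  have h : (shuffle φ).flip (word A []) = LinearMap.id := linearMap_ext_word fun w => by
    rw [LinearMap.flip_apply, shuffle_word_word, wordShuffle_nil_right]; rfl
  exact LinearMap.congr_fun h P

end basic

/-- The algebra `(A⟨X⟩, ⧢_φ, 1)`, when `⧢_φ` is associative and commutative. As an `A`-module it
is `A⟨X⟩`; its multiplication is the `φ`-shuffle, not the concatenation. -/
def ShuffleAlgebra {A : Type v} {X : Type u} [CommRing A] (φ : X → X → (X →₀ A))
    (_ha : ShuffleAssoc φ) (_hc : ShuffleComm φ) : Type (max u v) :=
  NCPoly A X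

namespace ShuffleAlgebra

variable {A : Type v} {X : Type u} [CommRing A] (φ : X → X → (X →₀ A))
  (ha : ShuffleAssoc φ) (hc : ShuffleComm φ)

instance instAddCommGroup : AddCommGroup (ShuffleAlgebra φ ha hc) :=
  inferInstanceAs (AddCommGroup (NCPoly A X))

instance instModule : Module A (ShuffleAlgebra φ ha hc) :=
  inferInstanceAs (Module A (NCPoly A X))

/-- The identity map of `A⟨X⟩`, seen as a linear equivalence onto `(A⟨X⟩, ⧢_φ, 1)`. -/
def of : NCPoly A X ≃ₗ[A] ShuffleAlgebra φ ha hc :=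
  LinearEquiv.refl A (NCPoly A X)

instance instCommRing : CommRing (ShuffleAlgebra φ ha hc) where
  __ := instAddCommGroup φ ha hc
  mul P Q := of φ ha hc (shuffle φ ((of φ ha hc).symm P) ((of φ ha hc).symm Q))
  one := of φ ha hc (word A [])
  mul_assoc P Q R := ha P Q R
  mul_comm P Q := hc P Q
  one_mul P := shuffle_one_left φ P
  mul_one P := shuffle_one_right φ P
  left_distrib P Q R := map_add (shuffle φ P) Q R
  right_distrib P Q R := LinearMap.map_add₂ (shuffle φ) P Q R
  zero_mul P := LinearMap.map_zero₂ (shuffle φ) P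
  mul_zero P := map_zero (shuffle φ P)

instance instAlgebra : Algebra A (ShuffleAlgebra φ ha hc) :=
  Algebra.ofModule
    (fun r P Q => LinearMap.map_smul₂ (shuffle φ) r P Q)
    (fun r P Q => map_smul (shuffle φ P) r Q)

theorem of_mul_of (P Q : NCPoly A X) :
    of φ ha hc P * of φ ha hc Q = of φ ha hc (shuffle φ P Q) := rfl

theorem one_eq : (1 : ShuffleAlgebra φ ha hc) = of φ ha hc (word A []) := rfl

end ShuffleAlgebra

/-- A Lyndon word: a nonempty word that is strictly smaller, in the lexicographic order, than each
of its nonempty proper right factors. -/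
def IsLyndon {X : Type u} [LinearOrder X] (w : List X) : Prop :=
  w ≠ [] ∧ ∀ u v : List X, u ≠ [] → v ≠ [] → w = u ++ v → w < v

/-- The set `Lyn(X)` of Lyndon words over the totally ordered alphabet `X`. -/
def Lyn (X : Type u) [LinearOrder X] : Set (List X) := {w | IsLyndon w}

end PhiShuffle

end

/-!
Radford's theorem for `φ`-shuffles, by triangularity.

Every word is, in exactly one way, a nonincreasing product `l₁ l₂ ⋯ lₖ` of Lyndon words
(`exists_lyndon_factorization`, `lyndon_factorization_unique`). So words correspond to monomials in
the Lyndon words, and it is enough to see that the shuffle `l₁ ⧢ ⋯ ⧢ lₖ` equals `c • l₁ ⋯ lₖ` plus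
smaller words, where `c` is a positive integer (`exists_prod_sub_nsmul_mem_lower`). Positive
integers are invertible in `A`, so the exact value of `c` is irrelevant. "Smaller" refers to the
well-founded relation `Precedes`: shorter, or a lexicographically smaller rearrangement.

The terms `φ(a, b)` only produce shorter words, so that up to these `u ⧢ v` is a sum of
interleavings of `u` and `v` (`exists_wordShuffle_sub_sum_mem_short`). What remains is combinatorial.

* If `l` is Lyndon and `l ≥ l₁ ≥ ⋯ ≥ lₖ`, then no interleaving of `l` with `l₁ ⋯ lₖ` exceeds
  `l l₁ ⋯ lₖ` (`IsShuffle.le_append_flatten`). This rests on an exchange argument: when `v ≤ u`, each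
  interleaving of `p u` with `v` is at most some interleaving of `u` with `p v`
  (`IsShuffle.exchange`). Hence letters should be taken from the larger of the two remaining words,
  and the right factors of `l` are larger than any product of Lyndon words below `l`
  (`IsLyndon.flatten_lt`).
* Interleaving with a fixed word is strictly monotone on words of a given length
  (`IsShuffle.exists_lt`), so smaller words stay smaller after a shuffle with `l`.
-/

namespace PhiShuffle

open List

/-! ### Lexicographic comparison of words -/

/-- If `u < v`, then either `u` is a proper prefix of `v`, or the comparison is decided at a letter
and therefore persists when both words are prolonged. -/
theorem prefix_or_append_lt_append {X : Type*} [LinearOrder X] {u v : List X} (h : u < v) :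
    (∃ t, t ≠ [] ∧ v = u ++ t) ∨ ∀ s t, u ++ s < v ++ t := by
  induction u generalizing v with
  | nil => exact .inl ⟨v, by rintro rfl; simp at h, rfl⟩
  | cons a u ih =>
    cases v with
    | nil => simp at h
    | cons b v =>
      rcases cons_lt_cons_iff.1 h with hab | ⟨rfl, huv⟩
      · exact .inr fun s t => cons_lt_cons_iff.2 (.inl hab)
      · rcases ih huv with ⟨t, ht, rfl⟩ | huv
        · exact .inl ⟨t, ht, rfl⟩
        · exact .inr fun s t => cons_lt_cons_iff.2 (.inr ⟨rfl, huv s t⟩)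

theorem le_append_right {X : Type*} [LinearOrder X] (u v : List X) : u ≤ u ++ v :=
  not_lt.1 (prefix_append u v).le

/-- `List.cons_le_cons_iff`, for the relation `≤` of the linear order on words, which is not
syntactically the one of the core library. -/
theorem cons_le_cons_iff_lex {X : Type*} [LinearOrder X] {a b : X} {u v : List X} :
    a :: u ≤ b :: v ↔ a < b ∨ a = b ∧ u ≤ v := by
  simp only [le_iff_lt_or_eq, cons_lt_cons_iff, cons.injEq]
  tauto

/-! ### Lyndon words -/

section Lyndon

variable {X : Type*} [LinearOrder X]

theorem IsLyndon.le_of_suffix {l y : List X} (hl : IsLyndon l) (hy : y ≠ []) (h : y <:+ l) :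
    l ≤ y := by
  obtain ⟨t, rfl⟩ := h
  rcases eq_or_ne t [] with rfl | ht
  · exact le_rfl
  · exact (hl.2 t y ht hy rfl).le

theorem isLyndon_singleton (a : X) : IsLyndon [a] := by
  refine ⟨by simp, fun u v hu hv h => ?_⟩
  have := congrArg length h
  have := length_pos_of_ne_nil hu
  have := length_pos_of_ne_nil hv
  simp at *
  omega

theorem IsLyndon.append {u v : List X} (hu : IsLyndon u) (hv : IsLyndon v) (huv : u < v) :
    IsLyndon (u ++ v) := by
  have key : u ++ v < v := by
    rcases prefix_or_append_lt_append huv with ⟨t, ht, rfl⟩ | h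
    · exact append_left_lt (hv.2 u t hu.1 ht rfl)
    · simpa using h v []
  refine ⟨by simp [hu.1], fun x y hx hy h => ?_⟩
  rcases append_eq_append_iff.1 h with ⟨s, rfl, rfl⟩ | ⟨s, rfl, rfl⟩
  · rcases eq_or_ne s [] with rfl | hs
    · simpa using key
    · exact key.trans (hv.2 s y hs hy rfl)
  · rcases eq_or_ne s [] with rfl | hs
    · simpa using key
    · rcases prefix_or_append_lt_append (hu.2 x s hx hs rfl) with ⟨t, ht, h⟩ | h
      · have := congrArg length h
        have := length_pos_of_ne_nil hx
        simp at *
        omega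
      · exact h v v

/-- A Lyndon word can be prepended to a nonincreasing sequence of Lyndon words, merging it with
its right neighbour as long as that neighbour is larger. -/
theorem exists_lyndon_cons (L : List (List X)) :
    ∀ l : List X, IsLyndon l → (∀ x ∈ L, IsLyndon x) → L.Pairwise (· ≥ ·) →
      ∃ L' : List (List X), (∀ x ∈ L', IsLyndon x) ∧ L'.Pairwise (· ≥ ·) ∧
        L'.flatten = l ++ L.flatten := by
  induction L with
  | nil => exact fun l hl _ _ => ⟨[l], by simpa using hl, by simp, by simp⟩
  | cons m L ih =>
    intro l hl hL hs
    rw [forall_mem_cons] at hL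
    rw [pairwise_cons] at hs
    rcases lt_or_ge l m with h | h
    · obtain ⟨L', h1, h2, h3⟩ := ih (l ++ m) (hl.append hL.1 h) hL.2 hs.2
      exact ⟨L', h1, h2, by simp [h3]⟩
    · refine ⟨l :: m :: L, by simpa using ⟨hl, hL⟩, ?_, by simp⟩
      simp only [pairwise_cons, forall_mem_cons]
      exact ⟨⟨h, fun x hx => (hs.1 x hx).trans h⟩, hs⟩

theorem exists_lyndon_factorization (w : List X) :
    ∃ L : List (List X), (∀ x ∈ L, IsLyndon x) ∧ L.Pairwise (· ≥ ·) ∧ L.flatten = w := by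
  induction w with
  | nil => exact ⟨[], by simp⟩
  | cons a w ih =>
    obtain ⟨L, h1, h2, rfl⟩ := ih
    exact exists_lyndon_cons L [a] (isLyndon_singleton a) h1 h2

/-- A product of words that are all smaller than a Lyndon word `l` is smaller than every nonempty
right factor of `l`. -/
theorem IsLyndon.flatten_lt {l : List X} (hl : IsLyndon l) (L : List (List X))
    (hL : ∀ x ∈ L, x < l) : ∀ y : List X, y ≠ [] → y <:+ l → L.flatten < y := by
  induction L with
  | nil =>
    intro y hy _
    cases y with
    | nil => exact absurd rfl hy
    | cons a y => simp
  | cons x L ih =>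
    intro y hy hyl
    rw [forall_mem_cons] at hL
    rcases prefix_or_append_lt_append (hL.1.trans_le (hl.le_of_suffix hy hyl)) with
      ⟨t, ht, rfl⟩ | h
    · exact append_left_lt (ih hL.2 t ht ((suffix_append x t).trans hyl))
    · simpa using h L.flatten []

theorem lyndon_factorization_unique {L : List (List X)} (hL : ∀ x ∈ L, IsLyndon x)
    (hs : L.Pairwise (· ≥ ·)) : ∀ {L' : List (List X)}, (∀ x ∈ L', IsLyndon x) →
      L'.Pairwise (· ≥ ·) → L.flatten = L'.flatten → L = L' := by
  -- a larger first factor would make the whole product larger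
  have aux : ∀ {l m : List X} {L M : List (List X)}, IsLyndon l → (m :: M).Pairwise (· ≥ ·) →
      m < l → (l :: L).flatten ≠ (m :: M).flatten := by
    intro l m L M hl hM hml h
    have h1 : (m :: M).flatten < l := by
      refine hl.flatten_lt _ ?_ l hl.1 suffix_rfl
      rw [forall_mem_cons]
      exact ⟨hml, fun x hx => ((pairwise_cons.1 hM).1 x hx).trans_lt hml⟩
    rw [← h] at h1
    exact absurd (le_append_right l L.flatten) (not_le_of_gt h1)
  induction L with
  | nil =>
    intro L' hL' _ h
    cases L' with
    | nil => rfl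
    | cons m M => exact absurd (by simpa using h.symm) (fun h : m = [] ∧ _ => (hL' m (by simp)).1 h.1)
  | cons l L ih =>
    intro L' hL' hs' h
    cases L' with
    | nil => exact absurd (by simpa using h) (fun h : l = [] ∧ _ => (hL l (by simp)).1 h.1)
    | cons m M =>
      rcases lt_trichotomy l m with hlm | rfl | hlm
      · exact absurd h.symm (aux (hL' m (by simp)) hs hlm)
      · rw [forall_mem_cons] at hL hL'
        rw [ih hL.2 (pairwise_cons.1 hs).2 hL'.2 (pairwise_cons.1 hs').2 (by simpa using h)]
      · exact absurd h (aux (hL l (by simp)) hs' hlm)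

end Lyndon

/-! ### Interleavings of two words -/

/-- `IsShuffle u v z`: the word `z` is an interleaving of `u` and `v`, that is, one of the words
of full length occurring in the shuffle of `u` and `v`. -/
inductive IsShuffle {X : Type*} : List X → List X → List X → Prop
  | nil : IsShuffle [] [] []
  | left (a : X) {u v z : List X} : IsShuffle u v z → IsShuffle (a :: u) v (a :: z)
  | right (a : X) {u v z : List X} : IsShuffle u v z → IsShuffle u (a :: v) (a :: z)

namespace IsShuffle

section

variable {X : Type*}

theorem symm {u v z : List X} (h : IsShuffle u v z) : IsShuffle v u z := by
  induction h with
  | nil => exact .nil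
  | left a _ ih => exact .right a ih
  | right a _ ih => exact .left a ih

theorem nil_left : ∀ v : List X, IsShuffle [] v v
  | [] => .nil
  | a :: v => .right a (nil_left v)

theorem append : ∀ u v : List X, IsShuffle u v (u ++ v)
  | [], v => nil_left v
  | a :: u, v => .left a (append u v)

theorem perm {u v z : List X} (h : IsShuffle u v z) : z ~ u ++ v := by
  induction h with
  | nil => exact .refl _
  | left a _ ih => exact ih.cons a
  | right a _ ih => exact (ih.cons a).trans perm_middle.symm

theorem eq_of_nil_left {v z : List X} (h : IsShuffle [] v z) : z = v := by
  generalize hu : ([] : List X) = u at h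
  induction h with
  | nil => rfl
  | left => cases hu
  | right a _ ih => rw [ih hu]

end

variable {X : Type*} [LinearOrder X]

/-- Replacing a word by a larger one of the same length makes its interleavings larger. -/
theorem exists_lt {u v z : List X} (h : IsShuffle u v z) :
    ∀ {w : List X}, v < w → v.length = w.length → ∃ z', IsShuffle u w z' ∧ z < z' := by
  induction h with
  | nil =>
    intro w hw hl
    cases w with
    | nil => simp at hw
    | cons => simp at hl
  | left a _ ih =>
    intro w hw hl
    obtain ⟨z', h1, h2⟩ := ih hw hl
    exact ⟨a :: z', .left a h1, cons_lt_cons_self.2 h2⟩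
  | @right b u v z _ ih =>
    intro w hw hl
    cases w with
    | nil => simp at hl
    | cons c w =>
      rcases cons_lt_cons_iff.1 hw with hbc | ⟨rfl, hvw⟩
      · exact ⟨c :: (u ++ w), .right c (append u w), cons_lt_cons_iff.2 (.inl hbc)⟩
      · obtain ⟨z', h1, h2⟩ := ih hvw (by simpa using hl)
        exact ⟨b :: z', .right b h1, cons_lt_cons_self.2 h2⟩

/-- Moving a left factor `p` from the larger word `u` to the smaller word `v` can only increase
the largest interleaving. -/
theorem exchange {z : List X} : ∀ {p u v : List X}, v ≤ u → IsShuffle (p ++ u) v z →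
    ∃ z', IsShuffle u (p ++ v) z' ∧ z ≤ z' := by
  induction z with
  | nil =>
    intro p u v _ h
    generalize hx : p ++ u = x at h
    cases h
    obtain ⟨rfl, rfl⟩ := append_eq_nil_iff.1 hx
    exact ⟨[], .nil, le_rfl⟩
  | cons c z ih =>
    intro p u v hvu h
    cases p with
    | nil => exact ⟨_, h, le_rfl⟩
    | cons a p =>
      cases h with
      | left _ h =>
        obtain ⟨z', h1, h2⟩ := ih hvu h
        exact ⟨c :: z', .right c h1, cons_le_cons_iff_lex.2 (.inr ⟨rfl, h2⟩)⟩
      | @right _ _ v _ h =>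
        cases u with
        | nil => exact absurd hvu (not_le_of_gt (by simp))
        | cons d u =>
          rcases cons_le_cons_iff_lex.1 hvu with hcd | ⟨rfl, hvu'⟩
          · exact ⟨d :: (u ++ (a :: p ++ c :: v)), .left d (append _ _),
              cons_le_cons_iff_lex.2 (.inl hcd)⟩
          · obtain ⟨z', h1, h2⟩ := ih (p := a :: p ++ [c]) hvu' (by simpa using h)
            exact ⟨c :: z', .left c (by simpa using h1), cons_le_cons_iff_lex.2 (.inr ⟨rfl, h2⟩)⟩

/-- If every nonempty right factor of `y`, followed by `s`, is at least `w`, then the largest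
interleaving of `y ++ s` and `w` exhausts `y` first. -/
theorem exists_le_append {s w : List X} (y : List X) :
    ∀ {z : List X}, (∀ y', y' ≠ [] → y' <:+ y → w ≤ y' ++ s) → IsShuffle (y ++ s) w z →
      ∃ z', IsShuffle s w z' ∧ z ≤ y ++ z' := by
  induction y with
  | nil => exact fun _ h => ⟨_, h, le_rfl⟩
  | cons a y ih =>
    intro z hy h
    have hy' : ∀ y', y' ≠ [] → y' <:+ y → w ≤ y' ++ s :=
      fun y' h1 h2 => hy y' h1 (h2.trans (suffix_cons a y))
    cases h with
    | left _ h =>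
      obtain ⟨z', h1, h2⟩ := ih hy' h
      exact ⟨z', h1, cons_le_cons_iff_lex.2 (.inr ⟨rfl, h2⟩)⟩
    | @right b _ w z h =>
      rcases cons_le_cons_iff_lex.1 (hy (a :: y) (by simp) suffix_rfl) with hba | ⟨rfl, hw⟩
      · exact ⟨_, append s _, cons_le_cons_iff_lex.2 (.inl hba)⟩
      · obtain ⟨z', h1, h2⟩ := exchange (p := [b]) hw h
        obtain ⟨z'', h3, h4⟩ := ih hy' h1
        exact ⟨z'', h3, cons_le_cons_iff_lex.2 (.inr ⟨rfl, h2.trans h4⟩)⟩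

/-- The largest interleaving of a Lyndon word `l` with a nonincreasing product of Lyndon words
not exceeding `l` is their concatenation. -/
theorem le_append_flatten {l : List X} (hl : IsLyndon l) (L : List (List X)) :
    ∀ {z : List X}, (l :: L).Pairwise (· ≥ ·) → IsShuffle l L.flatten z → z ≤ l ++ L.flatten := by
  induction L with
  | nil =>
    intro z _ h
    simp [h.symm.eq_of_nil_left]
  | cons m L ih =>
    intro z hs h
    obtain ⟨h1, h2⟩ := pairwise_cons.1 hs
    rw [forall_mem_cons] at h1
    rcases eq_or_lt_of_le h1.1 with rfl | hml
    · obtain ⟨z', h3, h4⟩ := exists_le_append m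
        (fun y' hy hyl => (hl.le_of_suffix hy hyl).trans (le_append_right _ _)) h.symm
      refine h4.trans ?_
      rcases eq_or_lt_of_le (ih h2 h3.symm) with rfl | h5
      · exact le_rfl
      · exact (append_left_lt h5).le
    · have hlt : ∀ x ∈ m :: L, x < l := by
        rw [forall_mem_cons]
        exact ⟨hml, fun x hx => ((pairwise_cons.1 h2).1 x hx).trans_lt hml⟩
      obtain ⟨z', h3, h4⟩ := exists_le_append (s := []) l
        (fun y' hy hyl => by simpa using (hl.flatten_lt _ hlt y' hy hyl).le) (by simpa using h)
      rwa [h3.eq_of_nil_left] at h4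

end IsShuffle

/-! ### The `φ`-shuffle up to shorter words -/

section Short

variable {A : Type*} {X : Type*} [CommRing A]

variable (A X) in
/-- The polynomials all of whose words have length less than `n`. -/
noncomputable def short (n : ℕ) : Submodule A (NCPoly A X) :=
  Submodule.span A (word A '' {w | w.length < n})

theorem word_mul_word (u v : List X) : word A u * word A v = word A (u ++ v) :=
  (map_mul (MonoidAlgebra.of A (FreeMonoid X)) _ _).symm

variable (A) in
/-- The coefficient of the word `w` in a noncommutative polynomial. -/
noncomputable def wordCoeff (w : List X) : NCPoly A X →ₗ[A] A :=
  Finsupp.lapply (FreeMonoid.ofList w) ∘ₗ (MonoidAlgebra.coeffLinearEquiv A).toLinearMap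

theorem wordCoeff_word_self (w : List X) : wordCoeff A w (word A w) = 1 := by
  simp [wordCoeff, word]

theorem wordCoeff_word_of_ne {v w : List X} (h : v ≠ w) : wordCoeff A w (word A v) = 0 := by
  simp [wordCoeff, word, h]

theorem word_mem_short {w : List X} {n : ℕ} (h : w.length < n) : word A w ∈ short A X n :=
  Submodule.subset_span ⟨w, h, rfl⟩

theorem short_mono {m n : ℕ} (h : m ≤ n) : short A X m ≤ short A X n :=
  Submodule.span_mono (Set.image_mono fun _ hw => lt_of_lt_of_le hw h)

theorem letter_mul_mem_short (a : X) {n : ℕ} {P : NCPoly A X} (hP : P ∈ short A X n) :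
    word A [a] * P ∈ short A X (n + 1) := by
  have : short A X n ≤ (short A X (n + 1)).comap (LinearMap.mulLeft A (word A [a])) := by
    rw [short, Submodule.span_le]
    rintro _ ⟨w, hw, rfl⟩
    simp only [Set.mem_ofPred_eq] at hw
    simpa [word_mul_word] using word_mem_short (by simpa using hw)
  exact this hP

theorem letters_mul_mem_short (f : X →₀ A) {n : ℕ} {P : NCPoly A X} (hP : P ∈ short A X n) :
    letters A X f * P ∈ short A X (n + 1) := by
  rw [letters, Finsupp.linearCombination_apply, Finsupp.sum, Finset.sum_mul]
  refine Submodule.sum_mem _ fun x _ => ?_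
  rw [smul_mul_assoc]
  exact Submodule.smul_mem _ _ (letter_mul_mem_short x hP)

theorem sum_word_mem_short {M : List (List X)} {n : ℕ} (h : ∀ z ∈ M, z.length < n) :
    (M.map (word A)).sum ∈ short A X n := by
  refine list_sum_mem fun P hP => ?_
  obtain ⟨z, hz, rfl⟩ := mem_map.1 hP
  exact word_mem_short (h z hz)

theorem sum_map_word_cons (a : X) (M : List (List X)) :
    ((M.map (a :: ·)).map (word A)).sum = word A [a] * (M.map (word A)).sum := by
  induction M with
  | nil => simp
  | cons z M ih =>
    simp only [map_cons, sum_cons, mul_add, word_mul_word, singleton_append] at ih ⊢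
    rw [ih]

/-- Up to shorter words, the `φ`-shuffle of two words is the sum of a list of their
interleavings, their concatenation among them. -/
theorem exists_wordShuffle_sub_sum_mem_short (φ : X → X → (X →₀ A)) : ∀ u v : List X,
    ∃ M : List (List X), u ++ v ∈ M ∧ (∀ z ∈ M, IsShuffle u v z) ∧
      wordShuffle φ u v - (M.map (word A)).sum ∈ short A X (u.length + v.length)
  | [], v => ⟨[v], by simp, by simpa using IsShuffle.nil_left v, by simp [wordShuffle_nil_left]⟩
  | a :: u, [] => ⟨[a :: u], by simp, by simpa using (IsShuffle.nil_left (a :: u)).symm,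
      by simp [wordShuffle_nil_right]⟩
  | a :: u, b :: v => by
    obtain ⟨M₁, h1, h2, h3⟩ := exists_wordShuffle_sub_sum_mem_short φ u (b :: v)
    obtain ⟨M₂, _, h4, h5⟩ := exists_wordShuffle_sub_sum_mem_short φ (a :: u) v
    obtain ⟨M₃, _, h6, h7⟩ := exists_wordShuffle_sub_sum_mem_short φ u v
    refine ⟨M₁.map (a :: ·) ++ M₂.map (b :: ·), ?_, ?_, ?_⟩
    · exact mem_append_left _ (mem_map_of_mem h1)
    · simp only [mem_append, mem_map]
      rintro z (⟨z, hz, rfl⟩ | ⟨z, hz, rfl⟩)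
      · exact .left a (h2 z hz)
      · exact .right b (h4 z hz)
    · have h8 : wordShuffle φ u v ∈ short A X (u.length + v.length + 1) := by
        have := Submodule.add_mem _ (short_mono (Nat.le_succ _) h7)
          (sum_word_mem_short (A := A) (M := M₃) (n := u.length + v.length + 1) fun z hz => by
            simp [(h6 z hz).perm.length_eq])
        rwa [sub_add_cancel] at this
      have h9 := letters_mul_mem_short (φ a b) h8
      have h10 := letter_mul_mem_short a h3
      have h11 := letter_mul_mem_short b h5
      rw [wordShuffle_cons_cons, map_append, sum_append, sum_map_word_cons, sum_map_word_cons]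
      convert Submodule.add_mem _ (Submodule.add_mem _ (short_mono ?_ h10) (short_mono ?_ h11))
        (short_mono ?_ h9) using 1
      · noncomm_ring
      all_goals simp only [length_cons]; omega
  termination_by u v => u.length + v.length

end Short

/-! ### Leading words -/

section Leading

variable {X : Type*} [LinearOrder X]

/-- The order in which leading words are taken: `v` precedes `w` if it is shorter, or if it is a
lexicographically smaller rearrangement of `w`. Restricting the lexicographic comparison to
rearrangements makes the order well-founded on any alphabet. -/
def Precedes (v w : List X) : Prop :=
  v.length < w.length ∨ v ~ w ∧ v < w

theorem Precedes.toLex_lt {v w : List X} (h : Precedes v w) :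
    toLex (v.length, v) < toLex (w.length, w) := by
  rw [Prod.Lex.toLex_lt_toLex]
  rcases h with h | ⟨h1, h2⟩
  · exact .inl h
  · exact .inr ⟨h1.length_eq, h2⟩

theorem Precedes.wellFounded : WellFounded (Precedes (X := X)) := by
  -- a word has only finitely many rearrangements, so the number of smaller ones decreases
  let r : List X → ℕ ×ₗ ℕ := fun w =>
    toLex (w.length, (w.permutations.toFinset.filter (· < w)).card)
  refine Subrelation.wf (r := InvImage (· < ·) r) ?_ (InvImage.wf r wellFounded_lt)
  rintro v w (h | ⟨h1, h2⟩)
  · exact Prod.Lex.toLex_lt_toLex.2 (.inl h)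
  · refine Prod.Lex.toLex_lt_toLex.2 (.inr ⟨h1.length_eq, ?_⟩)
    dsimp only
    refine Finset.card_lt_card ?_
    rw [Finset.ssubset_iff_of_subset]
    · exact ⟨v, by simpa using ⟨h1, h2⟩, by simp⟩
    · intro z
      simp only [Finset.mem_filter, mem_toFinset, mem_permutations]
      exact fun hz => ⟨hz.1.trans h1, hz.2.trans h2⟩

variable {A : Type*} [CommRing A]

variable (A) in
/-- The polynomials all of whose words precede `w`. -/
noncomputable def lower (w : List X) : Submodule A (NCPoly A X) :=
  Submodule.span A (word A '' {v | Precedes v w})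

theorem word_mem_lower {v w : List X} (h : Precedes v w) : word A v ∈ lower A w :=
  Submodule.subset_span ⟨v, h, rfl⟩

theorem short_le_lower {w : List X} {n : ℕ} (h : n ≤ w.length) : short A X n ≤ lower A w :=
  Submodule.span_mono (Set.image_mono fun _ hv => .inl (lt_of_lt_of_le hv h))

variable (φ : X → X → (X →₀ A))

/-- If every interleaving of `u` and `v` precedes `w`, then so does every word of their
`φ`-shuffle. -/
theorem wordShuffle_mem_lower {u v w : List X} (hw : u.length + v.length ≤ w.length)
    (h : ∀ z, IsShuffle u v z → Precedes z w) : wordShuffle φ u v ∈ lower A w := by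
  obtain ⟨M, _, h1, h2⟩ := exists_wordShuffle_sub_sum_mem_short φ u v
  rw [← sub_add_cancel (wordShuffle φ u v) (M.map (word A)).sum]
  refine Submodule.add_mem _ (short_le_lower hw h2) (list_sum_mem fun P hP => ?_)
  obtain ⟨z, hz, rfl⟩ := mem_map.1 hP
  exact word_mem_lower (h z (h1 z hz))

variable {l : List X} {L : List (List X)}

/-- The shuffle with a Lyndon word preserves the order of leading words. -/
theorem shuffle_mem_lower (hl : IsLyndon l) (hL : (l :: L).Pairwise (· ≥ ·)) {P : NCPoly A X}
    (hP : P ∈ lower A L.flatten) :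
    shuffle φ (word A l) P ∈ lower A (l ++ L.flatten) := by
  have : lower A L.flatten ≤ (lower A (l ++ L.flatten)).comap (shuffle φ (word A l)) := by
    rw [lower, Submodule.span_le]
    rintro _ ⟨v, hv, rfl⟩
    simp only [Set.mem_ofPred_eq] at hv
    simp only [SetLike.mem_coe, Submodule.mem_comap, shuffle_word_word]
    rcases hv with hv | ⟨h1, h2⟩
    · refine wordShuffle_mem_lower φ (by simpa using hv.le) fun z hz => .inl ?_
      simpa [hz.perm.length_eq] using hv
    · refine wordShuffle_mem_lower φ (by simp [h1.length_eq]) fun z hz => .inr ?_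
      obtain ⟨z', h3, h4⟩ := hz.exists_lt h2 h1.length_eq
      exact ⟨hz.perm.trans (h1.append_left l), h4.trans_le (IsShuffle.le_append_flatten hl L hL h3)⟩
  exact this hP

/-- The leading word of the shuffle of a Lyndon word with a nonincreasing product of Lyndon words
not exceeding it is their concatenation. -/
theorem exists_wordShuffle_sub_nsmul_mem_lower (hl : IsLyndon l)
    (hL : (l :: L).Pairwise (· ≥ ·)) :
    ∃ c : ℕ, 0 < c ∧
      wordShuffle φ l L.flatten - c • word A (l ++ L.flatten) ∈ lower A (l ++ L.flatten) := by
  obtain ⟨M, h1, h2, h3⟩ := exists_wordShuffle_sub_sum_mem_short φ l L.flatten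
  refine ⟨M.count (l ++ L.flatten), count_pos_iff.2 h1, ?_⟩
  have key : ∀ M : List (List X), (∀ z ∈ M, IsShuffle l L.flatten z) →
      (M.map (word A)).sum - M.count (l ++ L.flatten) • word A (l ++ L.flatten)
        ∈ lower A (l ++ L.flatten) := by
    intro M
    induction M with
    | nil => simp
    | cons z M ih =>
      intro hM
      rw [forall_mem_cons] at hM
      have h4 := ih hM.2
      rcases eq_or_lt_of_le (IsShuffle.le_append_flatten hl L hL hM.1) with rfl | h5
      · convert h4 using 1
        simp only [map_cons, sum_cons, count_cons_self, add_smul, one_smul]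
        abel
      · convert Submodule.add_mem _ (word_mem_lower (A := A) (.inr ⟨hM.1.perm, h5⟩)) h4 using 1
        simp only [map_cons, sum_cons, count_cons_of_ne h5.ne]
        abel
  have := Submodule.add_mem _ (short_le_lower (by simp) h3) (key M h2)
  rwa [sub_add_sub_cancel] at this

variable (ha : ShuffleAssoc φ) (hc : ShuffleComm φ)

/-- The leading word of the shuffle of a nonincreasing sequence of Lyndon words is their
concatenation, with a positive integer coefficient. -/
theorem exists_prod_sub_nsmul_mem_lower (L : List (List X)) : (∀ x ∈ L, IsLyndon x) →
    L.Pairwise (· ≥ ·) → ∃ c : ℕ, 0 < c ∧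
      (ShuffleAlgebra.of φ ha hc).symm (L.map fun x => ShuffleAlgebra.of φ ha hc (word A x)).prod
        - c • word A L.flatten ∈ lower A L.flatten := by
  induction L with
  | nil =>
    intro _ _
    refine ⟨1, one_pos, ?_⟩
    simp [ShuffleAlgebra.one_eq]
  | cons l L ih =>
    intro hL hs
    rw [forall_mem_cons] at hL
    obtain ⟨c, hc0, h1⟩ := ih hL.2 (pairwise_cons.1 hs).2
    obtain ⟨d, hd0, h2⟩ := exists_wordShuffle_sub_nsmul_mem_lower φ hL.1 hs
    refine ⟨c * d, Nat.mul_pos hc0 hd0, ?_⟩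
    have h3 := Submodule.add_mem _ (shuffle_mem_lower φ hL.1 hs h1)
      ((lower A (l ++ L.flatten)).nsmul_mem h2 c)
    rw [map_cons, prod_cons, flatten_cons]
    generalize (L.map fun x => ShuffleAlgebra.of φ ha hc (word A x)).prod = Q at h3 ⊢
    have h4 : (ShuffleAlgebra.of φ ha hc).symm (ShuffleAlgebra.of φ ha hc (word A l) * Q) =
      shuffle φ (word A l) ((ShuffleAlgebra.of φ ha hc).symm Q) := rfl
    rw [h4]
    convert h3 using 1
    rw [map_sub, map_nsmul, shuffle_word_word, smul_sub, mul_smul, sub_add_sub_cancel]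

end Leading

/-! ### Monomials in the Lyndon words -/

section Monomials

variable {X : Type*} [LinearOrder X]

/-- The Lyndon factors of a monomial in the Lyndon words, in nonincreasing order. -/
noncomputable def monomialFactors (m : Lyn X →₀ ℕ) : List (List X) :=
  ((Finsupp.toMultiset m).sort (· ≥ ·)).map Subtype.val

theorem isLyndon_of_mem_monomialFactors (m : Lyn X →₀ ℕ) : ∀ x ∈ monomialFactors m, IsLyndon x := by
  intro x hx
  obtain ⟨y, _, rfl⟩ := mem_map.1 hx
  exact y.2

theorem pairwise_monomialFactors (m : Lyn X →₀ ℕ) : (monomialFactors m).Pairwise (· ≥ ·) :=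
  pairwise_map.2 (Multiset.pairwise_sort _ _)

/-- Monomials in the Lyndon words correspond to words, by the unique factorization of a word into
a nonincreasing product of Lyndon words. -/
theorem bijective_flatten_monomialFactors :
    Function.Bijective fun m : Lyn X →₀ ℕ => (monomialFactors m).flatten := by
  constructor
  · intro m n h
    have h1 := lyndon_factorization_unique (isLyndon_of_mem_monomialFactors m)
      (pairwise_monomialFactors m) (isLyndon_of_mem_monomialFactors n)
      (pairwise_monomialFactors n) h
    have h2 := map_injective_iff.2 Subtype.val_injective h1
    apply Finsupp.orderIsoMultiset.injective
    simp only [Finsupp.coe_orderIsoMultiset]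
    rw [← Multiset.sort_eq (Finsupp.toMultiset m) (· ≥ ·), h2, Multiset.sort_eq]
  · intro w
    obtain ⟨L, h1, h2, rfl⟩ := exists_lyndon_factorization w
    lift L to List (Lyn X) using h1
    refine ⟨Multiset.toFinsupp (L : Multiset (Lyn X)), ?_⟩
    have h3 : L.Pairwise (· ≥ ·) := (pairwise_map (f := Subtype.val)).1 h2
    simp only [monomialFactors]
    congr 2
    refine Perm.eq_of_pairwise' (r := (· ≥ ·)) (Multiset.pairwise_sort _ _) h3 ?_
    rw [← Multiset.coe_eq_coe, Multiset.sort_eq]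
    simp

variable {A : Type*} [CommRing A] (φ : X → X → (X →₀ A)) (ha : ShuffleAssoc φ)
  (hc : ShuffleComm φ)

/-- The algebra map `A[t_l : l ∈ Lyn(X)] → (A⟨X⟩, ⧢_φ, 1)` sending each variable to its Lyndon
word. -/
noncomputable def lyndonEval : MvPolynomial (Lyn X) A →ₐ[A] ShuffleAlgebra φ ha hc :=
  MvPolynomial.aeval fun l : Lyn X => ShuffleAlgebra.of φ ha hc (word A l.1)

theorem lyndonEval_monomial (m : Lyn X →₀ ℕ) :
    lyndonEval φ ha hc (MvPolynomial.monomial m 1) =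
      ((monomialFactors m).map fun x => ShuffleAlgebra.of φ ha hc (word A x)).prod := by
  rw [lyndonEval, MvPolynomial.aeval_monomial, map_one, one_mul, monomialFactors, map_map,
    ← Multiset.prod_coe, ← Multiset.map_coe, Multiset.sort_eq, Finsupp.toMultiset_map, Finsupp.prod_toMultiset,
    Finsupp.prod_mapDomain_index (fun _ => pow_zero _) (fun _ _ _ => pow_add _ _ _)]
  rfl

theorem exists_lyndonEval_monomial_sub_mem_lower (m : Lyn X →₀ ℕ) : ∃ c : ℕ, 0 < c ∧
    (ShuffleAlgebra.of φ ha hc).symm (lyndonEval φ ha hc (MvPolynomial.monomial m 1))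
      - c • word A (monomialFactors m).flatten ∈ lower A (monomialFactors m).flatten := by
  rw [lyndonEval_monomial]
  exact exists_prod_sub_nsmul_mem_lower φ ha hc _ (isLyndon_of_mem_monomialFactors m)
    (pairwise_monomialFactors m)

theorem lyndonEval_surjective (hA : ∀ n : ℕ, 0 < n → IsUnit (n : A)) :
    Function.Surjective (lyndonEval φ ha hc) := by
  let f : MvPolynomial (Lyn X) A →ₗ[A] NCPoly A X :=
    (ShuffleAlgebra.of φ ha hc).symm.toLinearMap ∘ₗ (lyndonEval φ ha hc).toLinearMap
  have hword : ∀ w : List X, word A w ∈ LinearMap.range f := by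
    intro w
    induction w using (Precedes.wellFounded (X := X)).induction with
    | _ w ih =>
      obtain ⟨m, rfl⟩ := bijective_flatten_monomialFactors.2 w
      obtain ⟨c, hc0, h⟩ := exists_lyndonEval_monomial_sub_mem_lower φ ha hc m
      have hle : lower A (monomialFactors m).flatten ≤ LinearMap.range f := by
        rw [lower, Submodule.span_le]
        rintro _ ⟨v, hv, rfl⟩
        exact ih v hv
      have h1 := Submodule.sub_mem _
        (LinearMap.mem_range_self f (MvPolynomial.monomial m 1)) (hle h)
      have h2 : (c : A) • word A (monomialFactors m).flatten ∈ LinearMap.range f := by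
        rw [Nat.cast_smul_eq_nsmul]
        convert h1 using 1
        exact (sub_sub_cancel _ _).symm
      exact ((LinearMap.range f).smul_mem_iff_of_isUnit (hA c hc0)).1 h2
  intro P
  have : (LinearMap.range f).mkQ = 0 := linearMap_ext_word fun w => by simpa using hword w
  have hP : (ShuffleAlgebra.of φ ha hc).symm P ∈ LinearMap.range f := by
    simpa using LinearMap.congr_fun this ((ShuffleAlgebra.of φ ha hc).symm P)
  obtain ⟨p, hp⟩ := hP
  exact ⟨p, (ShuffleAlgebra.of φ ha hc).symm.injective hp⟩

theorem wordCoeff_of_mem_lower {v w : List X} (h : ¬ Precedes w v) {P : NCPoly A X}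
    (hP : P ∈ lower A v) : wordCoeff A w P = 0 := by
  have : lower A v ≤ LinearMap.ker (wordCoeff A w) := by
    rw [lower, Submodule.span_le]
    rintro _ ⟨u, hu, rfl⟩
    exact wordCoeff_word_of_ne fun huw => h (huw ▸ hu)
  exact this hP

theorem lyndonEval_injective (hA : ∀ n : ℕ, 0 < n → IsUnit (n : A)) :
    Function.Injective (lyndonEval φ ha hc) := by
  rw [injective_iff_map_eq_zero]
  intro p hp
  by_contra hp0
  -- the coefficient at the largest word attached to a monomial of `p` comes from that monomial only
  obtain ⟨m, hm, hmax⟩ := p.support.exists_max_image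
    (fun m => toLex ((monomialFactors m).flatten.length, (monomialFactors m).flatten))
    (MvPolynomial.support_nonempty.2 hp0)
  set w := (monomialFactors m).flatten with hw
  let f : MvPolynomial (Lyn X) A →ₗ[A] A := wordCoeff A w ∘ₗ
    (ShuffleAlgebra.of φ ha hc).symm.toLinearMap ∘ₗ (lyndonEval φ ha hc).toLinearMap
  have hf : ∀ n ∈ p.support, ∃ c : ℕ, 0 < c ∧ f (MvPolynomial.monomial n 1) =
      c • wordCoeff A w (word A (monomialFactors n).flatten) := by
    intro n hn
    obtain ⟨c, hc0, h⟩ := exists_lyndonEval_monomial_sub_mem_lower φ ha hc n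
    have h1 := wordCoeff_of_mem_lower (fun h => absurd h.toLex_lt (not_lt_of_ge (hmax n hn))) h
    rw [map_sub, map_nsmul, sub_eq_zero] at h1
    exact ⟨c, hc0, h1⟩
  have hfp : f p = p.coeff m * f (MvPolynomial.monomial m 1) := by
    conv_lhs => rw [p.as_sum, map_sum]
    have hmon : ∀ n, f (MvPolynomial.monomial n (p.coeff n)) =
        p.coeff n * f (MvPolynomial.monomial n 1) := fun n => by
      rw [← smul_eq_mul, ← map_smul, MvPolynomial.smul_monomial, smul_eq_mul, mul_one]
    simp only [hmon]
    refine Finset.sum_eq_single_of_mem m hm fun n hn hnm => ?_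
    obtain ⟨c, -, h⟩ := hf n hn
    rw [h, wordCoeff_word_of_ne fun h => hnm (bijective_flatten_monomialFactors.1 h), smul_zero,
      mul_zero]
  obtain ⟨c, hc0, h⟩ := hf m hm
  have hfp0 : f p = 0 := by simp [f, hp]
  rw [hfp, h, ← hw, wordCoeff_word_self, nsmul_one, (hA c hc0).mul_left_eq_zero] at hfp0
  exact MvPolynomial.mem_support_iff.1 hm hfp0

end Monomials

end PhiShuffle

theorem mainTheorem2 {A : Type*} [CommRing A] [Nontrivial A]
    (hA : ∀ n : ℕ, 0 < n → IsUnit (n : A))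
    {X : Type*} [LinearOrder X] (φ : X → X → (X →₀ A))
    (ha : PhiShuffle.ShuffleAssoc φ) (hc : PhiShuffle.ShuffleComm φ) :
    (∃ e : MvPolynomial (PhiShuffle.Lyn X) A ≃ₐ[A] PhiShuffle.ShuffleAlgebra φ ha hc,
      ∀ l : PhiShuffle.Lyn X,
        e (MvPolynomial.X l) = PhiShuffle.ShuffleAlgebra.of φ ha hc (PhiShuffle.word A l.1)) ∧
    IsTranscendenceBasis A
      (fun l : PhiShuffle.Lyn X =>
        PhiShuffle.ShuffleAlgebra.of φ ha hc (PhiShuffle.word A l.1)) := by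
  let e := AlgEquiv.ofBijective (PhiShuffle.lyndonEval φ ha hc)
    ⟨PhiShuffle.lyndonEval_injective φ ha hc hA, PhiShuffle.lyndonEval_surjective φ ha hc hA⟩
  have he : ∀ l : PhiShuffle.Lyn X,
      e (MvPolynomial.X l) = PhiShuffle.ShuffleAlgebra.of φ ha hc (PhiShuffle.word A l.1) :=
    fun l => MvPolynomial.aeval_X _ l
  refine ⟨⟨e, he⟩, ?_⟩
  have h := e.isTranscendenceBasis (IsTranscendenceBasis.mvPolynomial (PhiShuffle.Lyn X) A)
  rwa [show e ∘ MvPolynomial.X = _ from funext he] at h
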